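/- Let $d\ge 1$ and $n_1,\dots,n_d$ be natural numbers, and equip $E=\mathbb{C}^{n_1\times\cdots\times n_d}$ with $\langle\mathcal X,\mathcal Y\rangle=\sum_{i_1,\dots,i_d}\overline{\mathcal X(i_1,\dots,i_d)}\,\mathcal Y(i_1,\dots,i_d)$ and the Frobenius norm $\|\cdot\|_{\mathrm F}$. The TT rank of $\mathcal X\in E$ is $\mathrm{rank}_{\mathrm{TT}}(\mathcal X)=(1,\mathrm{rank}\,\mathbf X_{\langle 1\rangle},\dots,\mathrm{rank}\,\mathbf X_{\langle d-1\rangle},1)$, where $\mathbf X_{\langle k\rangle}\in\mathbb C^{(n_1\cdots n_k)\times(n_{k+1}\cdots n_d)}$ is the $k$-th unfolding of $\mathcal X$. For $\mathbf r=(r_0,\dots,r_d)$ with $r_0=r_d=1$ let $$\mathcal M_{\mathbf r}=\{\mathcal X\in E:\mathrm{rank}_{\mathrm{TT}}(\mathcal X)=\mathbf r\},\qquad \mathcal B_1=\{\mathcal X\in E:\|\mathcal X\|_{\mathrm F}=1\},\qquad \mathcal N_{\mathbf r}=\mathcal M_{\mathbf r}\cap\mathcal B_1 ,$$ and let $\mathcal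 X\in\mathcal N_{\mathbf r}$. For cores $\mathcal U_k\in\mathbb C^{r_{k-1}\times n_k\times r_k}$ with slices $\mathbf U_k(i)=\mathcal U_k(:,i,:)$, write $[\![\mathcal U_1,\dots,\mathcal U_d]\!]$ for the tensor with entries $\mathbf U_1(i_1)\cdots\mathbf U_d(i_d)$, and $\mathrm L(\mathcal U_k)\in\mathbb C^{(r_{k-1}n_k)\times r_k}$ for the left unfolding. For a linear subspace $T$, let $\mathrm P_T$ be the orthogonal projection of $E$ onto $T$. (a) Suppose that $\mathcal X=[\![\mathcal U_1,\dots,\mathcal U_d]\!]$ with left-orthogonal cores, i.e. $\mathrm L(\mathcal U_k)^\dagger\mathrm L(\mathcal U_k)=\mathbf I_{r_k}$ for $k=1,\dots,d-1$. Let $\mathrm T_{\mathcal X}\mathcal M_{\mathbf r}$ be the complex subspace of all tensors $$\sum_{k=1}^d[\![\mathcal U_1,\dots,\mathcal U_{k-1},\dot{\mathcal U}_k,\mathcal U_{k+1},\dots,\mathcal U_d]\!],\qquad \dot{\mathcal U}_k\in\mathbb C^{r_{k-1}\times n_k\times r_k},\quad \mathrm L(\dot{\mathcal U}_k)^\dagger\mathrm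 L(\mathcal U_k)=0\ \ (1\le k\le d-1),$$ let $\mathrm T_{\mathcal X}\mathcal N_{\mathbf r}$ be the complex subspace of all such sums whose parameters satisfy in addition $\langle\dot{\mathcal U}_d,\mathcal U_d\rangle=0$, and let $\mathrm T_{\mathcal X}\mathcal B_1=\{\mathcal V\in E:\langle\mathcal V,\mathcal X\rangle=0\}$. Then $$\mathrm P_{\mathrm T_{\mathcal X}\mathcal N_{\mathbf r}}=\mathrm P_{\mathrm T_{\mathcal X}\mathcal B_1}\circ\mathrm P_{\mathrm T_{\mathcal X}\mathcal M_{\mathbf r}}=\mathrm P_{\mathrm T_{\mathcal X}\mathcal M_{\mathbf r}}\circ\mathrm P_{\mathrm T_{\mathcal X}\mathcal B_1}.$$ (b) The same identities hold when $\mathrm T_{\mathcal X}\mathcal M_{\mathbf r}$, $\mathrm T_{\mathcal X}\mathcal B_1$ and $\mathrm T_{\mathcal X}\mathcal N_{\mathbf r}$ denote the tangent spaces at $\mathcal X$ of these sets in the real Euclidean space $E$ with inner product $\mathrm{Re}\langle\cdot,\cdot\rangle$, i.e. the real subspaces spanned by the velocities $\dot\gamma(0)$ of the curves $\gamma$ in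 the set that are smooth near $0$ and satisfy $\gamma(0)=\mathcal X$, and $\mathrm P$ denotes the orthogonal projection for $\mathrm{Re}\langle\cdot,\cdot\rangle$. -/

import Mathlib

open scoped Matrix ContDiff Topology

noncomputable section

namespace NTT

/-- Complex tensors of size `n 0 × ⋯ × n (d-1)`, with the inner product
`⟪X, Y⟫ = ∑ i, conj (X i) * Y i` and the Frobenius norm. As a real inner product space it carries
the real part of this inner product. -/
abbrev Tensor {d : ℕ} (n : Fin d → ℕ) : Type := EuclideanSpace ℂ ((k : Fin d) → Fin (n k))

/-! ### Unfoldings and the tensor train rank -/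

/-- Glue the indices of the modes `j < k` and of the modes `j ≥ k`. -/
def glue {d : ℕ} {n : Fin d → ℕ} (k : ℕ)
    (a : (j : {j : Fin d // (j : ℕ) < k}) → Fin (n j))
    (b : (j : {j : Fin d // ¬ (j : ℕ) < k}) → Fin (n j)) (j : Fin d) : Fin (n j) :=
  if h : (j : ℕ) < k then a ⟨j, h⟩ else b ⟨j, h⟩

/-- The `k`-th unfolding: rows are indexed by the first `k` modes, columns by the others
(by multi-indices instead of their linear enumeration). -/
def unfolding {d : ℕ} {n : Fin d → ℕ} (X : Tensor n) (k : ℕ) :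
    Matrix ((j : {j : Fin d // (j : ℕ) < k}) → Fin (n j))
      ((j : {j : Fin d // ¬ (j : ℕ) < k}) → Fin (n j)) ℂ :=
  Matrix.of fun a b => X (glue k a b)

/-- The tensor train rank `(1, rank X⟨1⟩, …, rank X⟨d-1⟩, 1)`. -/
def ttRank {d : ℕ} {n : Fin d → ℕ} (X : Tensor n) (k : Fin (d + 1)) : ℕ :=
  if k = 0 ∨ k = Fin.last d then 1 else (unfolding X k).rank

/-- Tensors of tensor train rank `r`. -/
def fixedRank {d : ℕ} (n : Fin d → ℕ) (r : Fin (d + 1) → ℕ) : Set (Tensor n) :=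
  {X | ttRank X = r}

/-- Tensors of unit Frobenius norm. -/
def unitSphere {d : ℕ} (n : Fin d → ℕ) : Set (Tensor n) :=
  {X | ‖X‖ = 1}

/-- Unit-norm tensors of tensor train rank `r`. -/
def normalizedFixedRank {d : ℕ} (n : Fin d → ℕ) (r : Fin (d + 1) → ℕ) : Set (Tensor n) :=
  {X | ttRank X = r ∧ ‖X‖ = 1}

/-! ### Tensor train decompositions -/

/-- Core tensors: `U k i` is the slice `U_k(:, i, :)`, an `r_{k-1} × r_k` matrix. -/
abbrev Cores {d : ℕ} (n : Fin d → ℕ) (r : Fin (d + 1) → ℕ) : Type :=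
  (k : Fin d) → Fin (n k) → Matrix (Fin (r k.castSucc)) (Fin (r k.succ)) ℂ

/-- The product `U_1(i_1) ⋯ U_k(i_k)` of the first `k` slices. -/
def partialProd {d : ℕ} {n : Fin d → ℕ} {r : Fin (d + 1) → ℕ} (U : Cores n r)
    (i : (k : Fin d) → Fin (n k)) (k : Fin (d + 1)) : Matrix (Fin (r 0)) (Fin (r k)) ℂ :=
  Fin.induction (motive := fun k => Matrix (Fin (r 0)) (Fin (r k)) ℂ) 1
    (fun k P => P * U k (i k)) k

/-- The tensor `⟦U_1, …, U_d⟧` with entries `U_1(i_1) ⋯ U_d(i_d)`, a `1 × 1` matrix. -/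
def ttTensor {d : ℕ} {n : Fin d → ℕ} {r : Fin (d + 1) → ℕ} (h₀ : r 0 = 1)
    (h₁ : r (Fin.last d) = 1) (U : Cores n r) : Tensor n :=
  WithLp.toLp 2 fun i => partialProd U i (Fin.last d) ⟨0, by omega⟩ ⟨0, by omega⟩

/-- The left unfolding of a core tensor, of size `(r_{k-1} n_k) × r_k`. -/
def leftUnfolding {p m q : ℕ} (A : Fin m → Matrix (Fin p) (Fin q) ℂ) :
    Matrix (Fin p × Fin m) (Fin q) ℂ :=
  Matrix.of fun a b => A a.2 a.1 b

/-- The inner product of two core tensors. -/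
def coreInner {p m q : ℕ} (A B : Fin m → Matrix (Fin p) (Fin q) ℂ) : ℂ :=
  ∑ a, ∑ i, ∑ b, star (A i a b) * B i a b

/-- All cores except possibly the last one have left unfoldings with orthonormal columns. -/
def LeftOrthogonal {d : ℕ} {n : Fin d → ℕ} {r : Fin (d + 1) → ℕ} (U : Cores n r) : Prop :=
  ∀ k : Fin d, (k : ℕ) + 1 < d → (leftUnfolding (U k))ᴴ * leftUnfolding (U k) = 1

/-- The gauge conditions `L(W_k)ᴴ L(U_k) = 0` for all `k` except the last one. -/
def Gauged {d : ℕ} {n : Fin d → ℕ} {r : Fin (d + 1) → ℕ} (U W : Cores n r) : Prop :=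
  ∀ k : Fin d, (k : ℕ) + 1 < d → (leftUnfolding (W k))ᴴ * leftUnfolding (U k) = 0

/-- The orthogonality `⟪W_d, U_d⟫ = 0` of the last cores. -/
def LastOrthogonal {d : ℕ} {n : Fin d → ℕ} {r : Fin (d + 1) → ℕ} (U W : Cores n r) : Prop :=
  ∀ k : Fin d, (k : ℕ) + 1 = d → coreInner (W k) (U k) = 0

/-- `⟦W_1, U_2, …, U_d⟧ + ⟦U_1, W_2, U_3, …, U_d⟧ + ⋯ + ⟦U_1, …, U_{d-1}, W_d⟧`. -/
def variation {d : ℕ} {n : Fin d → ℕ} {r : Fin (d + 1) → ℕ} (h₀ : r 0 = 1)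
    (h₁ : r (Fin.last d) = 1) (U W : Cores n r) : Tensor n :=
  ∑ k, ttTensor h₀ h₁ (Function.update U k (W k))

section Linearity

variable {d : ℕ} {n : Fin d → ℕ} {r : Fin (d + 1) → ℕ}

theorem partialProd_zero (U : Cores n r) (i : (k : Fin d) → Fin (n k)) :
    partialProd U i 0 = 1 := rfl

theorem partialProd_succ (U : Cores n r) (i : (k : Fin d) → Fin (n k)) (k : Fin d) :
    partialProd U i k.succ = partialProd U i k.castSucc * U k (i k) := by
  simp [partialProd, Fin.induction_succ]

theorem partialProd_update_of_le (U : Cores n r) (i : (k : Fin d) → Fin (n k)) (k : Fin d)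
    (A : Fin (n k) → Matrix (Fin (r k.castSucc)) (Fin (r k.succ)) ℂ) (m : Fin (d + 1)) :
    (m : ℕ) ≤ k → partialProd (Function.update U k A) i m = partialProd U i m := by
  induction m using Fin.induction with
  | zero => intro _; rfl
  | succ m ih =>
    intro h
    have hm : (m : ℕ) + 1 ≤ k := by simpa using h
    have hne : m ≠ k := by intro e; subst e; omega
    rw [partialProd_succ, partialProd_succ, ih (by simp; omega), Function.update_of_ne hne]

theorem partialProd_update_lin (U : Cores n r) (i : (k : Fin d) → Fin (n k)) (k : Fin d)
    (A B : Fin (n k) → Matrix (Fin (r k.castSucc)) (Fin (r k.succ)) ℂ) (c : ℂ)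
    (m : Fin (d + 1)) :
    (k : ℕ) < m → partialProd (Function.update U k (c • A + B)) i m =
      c • partialProd (Function.update U k A) i m + partialProd (Function.update U k B) i m := by
  induction m using Fin.induction with
  | zero => intro h; simp at h
  | succ m ih =>
    intro h
    have hm : (k : ℕ) < m + 1 := by simpa using h
    simp only [partialProd_succ]
    by_cases e : m = k
    · subst e
      simp only [Function.update_self]
      rw [partialProd_update_of_le U i m _ _ (by simp),
        partialProd_update_of_le U i m _ _ (by simp),
        partialProd_update_of_le U i m _ _ (by simp)]
      simp [Matrix.mul_add]
    · have hlt : (k : ℕ) < m := by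
        have : (m : ℕ) ≠ k := fun h => e (Fin.ext h)
        omega
      simp only [Function.update_of_ne e]
      rw [ih (by simpa using hlt)]
      simp [Matrix.add_mul]

theorem variation_lin (h₀ : r 0 = 1) (h₁ : r (Fin.last d) = 1) (U V W : Cores n r) (c : ℂ) :
    variation h₀ h₁ U (c • V + W) = c • variation h₀ h₁ U V + variation h₀ h₁ U W := by
  unfold variation
  rw [Finset.smul_sum, ← Finset.sum_add_distrib]
  refine Finset.sum_congr rfl fun k _ => ?_
  ext i
  simp only [ttTensor, PiLp.add_apply, PiLp.smul_apply, Pi.add_apply, Pi.smul_apply]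
  rw [partialProd_update_lin U i k (V k) (W k) c _ (by simp)]
  simp

theorem Gauged.lin {U V W : Cores n r} (hV : Gauged U V) (hW : Gauged U W) (c : ℂ) :
    Gauged U (c • V + W) := by
  intro k hk
  have e : leftUnfolding ((c • V + W) k) = c • leftUnfolding (V k) + leftUnfolding (W k) := by
    ext a b; simp [leftUnfolding]
  rw [e, Matrix.conjTranspose_add, Matrix.conjTranspose_smul, Matrix.add_mul, Matrix.smul_mul,
    hV k hk, hW k hk]
  simp

theorem LastOrthogonal.lin {U V W : Cores n r} (hV : LastOrthogonal U V)
    (hW : LastOrthogonal U W) (c : ℂ) : LastOrthogonal U (c • V + W) := by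
  intro k hk
  have e : coreInner ((c • V + W) k) (U k) =
      star c * coreInner (V k) (U k) + coreInner (W k) (U k) := by
    simp [coreInner, add_mul, Finset.sum_add_distrib, Finset.mul_sum, mul_assoc]
  rw [e, hV k hk, hW k hk]
  simp

theorem Gauged.zero (U : Cores n r) : Gauged U 0 := by
  intro k _
  have e : leftUnfolding ((0 : Cores n r) k) = 0 := by ext a b; simp [leftUnfolding]
  rw [e]; simp

theorem LastOrthogonal.zero (U : Cores n r) : LastOrthogonal U 0 := by
  intro k _
  simp [coreInner]

theorem variation_zero (h₀ : r 0 = 1) (h₁ : r (Fin.last d) = 1) (U : Cores n r) :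
    variation h₀ h₁ U 0 = 0 := by
  have h := variation_lin h₀ h₁ U 0 0 1
  simpa using h

end Linearity

/-! ### Parametrized tangent spaces (complex subspaces) -/

/-- The tangent space of the tensors of tensor train rank `r` at `⟦U_1, …, U_d⟧`. -/
def tangentFixedRank {d : ℕ} {n : Fin d → ℕ} {r : Fin (d + 1) → ℕ} (h₀ : r 0 = 1)
    (h₁ : r (Fin.last d) = 1) (U : Cores n r) : Submodule ℂ (Tensor n) where
  carrier := {T | ∃ W : Cores n r, Gauged U W ∧ T = variation h₀ h₁ U W}
  add_mem' := by
    rintro _ _ ⟨V, hV, rfl⟩ ⟨W, hW, rfl⟩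
    refine ⟨(1 : ℂ) • V + W, hV.lin hW 1, ?_⟩
    rw [variation_lin, one_smul]
  zero_mem' := ⟨0, Gauged.zero U, (variation_zero h₀ h₁ U).symm⟩
  smul_mem' := by
    rintro c _ ⟨V, hV, rfl⟩
    refine ⟨c • V + 0, hV.lin (Gauged.zero U) c, ?_⟩
    rw [variation_lin, variation_zero, add_zero]

/-- The complex tangent space `{V | ⟪V, X⟫ = 0}` of the unit sphere at `X`. -/
def tangentUnitSphere {d : ℕ} {n : Fin d → ℕ} (X : Tensor n) : Submodule ℂ (Tensor n) where
  carrier := {V | inner ℂ V X = 0}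
  add_mem' := by
    intro V W hV hW
    simp only [Set.mem_ofPred_eq] at hV hW ⊢
    rw [inner_add_left, hV, hW, add_zero]
  zero_mem' := inner_zero_left X
  smul_mem' := by
    intro c V hV
    simp only [Set.mem_ofPred_eq] at hV ⊢
    rw [inner_smul_left, hV, mul_zero]

/-- The tangent space of the unit-norm tensors of tensor train rank `r` at `⟦U_1, …, U_d⟧`. -/
def tangentNormalizedFixedRank {d : ℕ} {n : Fin d → ℕ} {r : Fin (d + 1) → ℕ} (h₀ : r 0 = 1)
    (h₁ : r (Fin.last d) = 1) (U : Cores n r) : Submodule ℂ (Tensor n) where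
  carrier := {T | ∃ W : Cores n r, Gauged U W ∧ LastOrthogonal U W ∧ T = variation h₀ h₁ U W}
  add_mem' := by
    rintro _ _ ⟨V, hV, hV', rfl⟩ ⟨W, hW, hW', rfl⟩
    refine ⟨(1 : ℂ) • V + W, hV.lin hW 1, hV'.lin hW' 1, ?_⟩
    rw [variation_lin, one_smul]
  zero_mem' := ⟨0, Gauged.zero U, LastOrthogonal.zero U, (variation_zero h₀ h₁ U).symm⟩
  smul_mem' := by
    rintro c _ ⟨V, hV, hV', rfl⟩
    refine ⟨c • V + 0, hV.lin (Gauged.zero U) c, hV'.lin (LastOrthogonal.zero U) c, ?_⟩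
    rw [variation_lin, variation_zero, add_zero]

/-! ### Real tangent spaces of embedded submanifolds -/

/-- `v` is the velocity at time `0` of a smooth curve that runs in `S` and passes through `x`. -/
def IsVelocity {E : Type*} [NormedAddCommGroup E] [NormedSpace ℝ E] (S : Set E) (x v : E) : Prop :=
  ∃ γ : ℝ → E, ContDiffAt ℝ ∞ γ 0 ∧ γ 0 = x ∧ (∀ᶠ t in 𝓝 (0 : ℝ), γ t ∈ S) ∧ HasDerivAt γ v 0

/-- The real tangent space of `S` at `x`. For an embedded submanifold the velocities already form
a subspace; taking the span only makes the definition meaningful for every set. -/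
def realTangentSpace {E : Type*} [NormedAddCommGroup E] [NormedSpace ℝ E] (S : Set E) (x : E) :
    Submodule ℝ E :=
  Submodule.span ℝ {v | IsVelocity S x v}

end NTT

end

namespace NTT

/-! ### Products of orthogonal projections -/

section Projections

variable {𝕜 E : Type*} [RCLike 𝕜] [NormedAddCommGroup E] [InnerProductSpace 𝕜 E]
  [FiniteDimensional 𝕜 E]

/-! Both parts rest on one fact: if `Lᗮ ≤ K`, then the projections onto `K` and `L` commute and
their product projects onto `K ⊓ L`. Here `L` is the hyperplane `Xᗮ`, so it remains to show that `X`
lies in the tangent space `K` of the fixed-rank set and that the tangent space of the normalized set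
is `K ⊓ Xᗮ`.

For the parametrized spaces, left-orthogonality makes the interface Gram matrices nonzero multiples
of the identity. The gauge conditions then kill every term of `⟪variation, X⟫` except the last,
which is a nonzero multiple of `⟪W_d, U_d⟫` (`inner_variation_eq_zero_iff`).

For the velocity spaces, only invariance of the TT rank under positive scaling matters: normalizing
a curve projects its velocity onto `Xᗮ` (`realTangentSpace_inter_sphere`). No manifold structure is
needed. -/

theorem starProjection_inf_of_orthogonal_le {K L : Submodule 𝕜 E} (h : Lᗮ ≤ K) :
    (K ⊓ L).starProjection = L.starProjection ∘L K.starProjection := by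
  ext v
  have hr : ∀ w, w - L.starProjection w ∈ Lᗮ := fun w =>
    L.sub_starProjection_mem_orthogonal w
  have hK : v - K.starProjection v ∈ Kᗮ := K.sub_starProjection_mem_orthogonal v
  have hvK : K.starProjection v ∈ K := K.starProjection_apply_mem v
  refine Submodule.eq_starProjection_of_mem_orthogonal ⟨?_, L.starProjection_apply_mem _⟩ ?_
  -- The correction made by projecting onto `L` lies in `Lᗮ ≤ K`, so it does not leave `K`.
  · have := K.sub_mem hvK (h (hr (K.starProjection v)))
    simpa using this
  · have e : v - (L.starProjection ∘L K.starProjection) v =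
        (v - K.starProjection v) +
          (K.starProjection v - L.starProjection (K.starProjection v)) := by
      simp
    rw [e]
    exact Submodule.add_mem _ (Submodule.orthogonal_le inf_le_left hK)
      (Submodule.orthogonal_le inf_le_right (hr _))

/-- The product is itself an orthogonal projection, hence self-adjoint, and taking adjoints reverses
the factors. -/
theorem starProjection_comp_comm_of_orthogonal_le {K L : Submodule 𝕜 E} (h : Lᗮ ≤ K) :
    L.starProjection ∘L K.starProjection = K.starProjection ∘L L.starProjection := by
  have : CompleteSpace E := FiniteDimensional.complete 𝕜 E
  have hs : ∀ P : Submodule 𝕜 E, ContinuousLinearMap.adjoint P.starProjection =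
      P.starProjection := fun P =>
    ContinuousLinearMap.isSelfAdjoint_iff'.mp (isSelfAdjoint_starProjection P)
  have e := hs (K ⊓ L)
  rw [starProjection_inf_of_orthogonal_le h, ContinuousLinearMap.adjoint_comp, hs, hs] at e
  exact e.symm

/-- The projection identities for a subspace and the hyperplane orthogonal to one of its
elements. -/
theorem starProjection_identities {K L N : Submodule 𝕜 E} {x : E} (hx : x ∈ K)
    (hL : L = (𝕜 ∙ x)ᗮ) (hN : N = K ⊓ L) :
    N.starProjection = L.starProjection ∘L K.starProjection ∧
      L.starProjection ∘L K.starProjection = K.starProjection ∘L L.starProjection := by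
  have h : Lᗮ ≤ K := by
    rw [hL, Submodule.orthogonal_orthogonal]
    simpa using hx
  rw [hN]
  exact ⟨starProjection_inf_of_orthogonal_le h, starProjection_comp_comm_of_orthogonal_le h⟩

end Projections

/-! ### Velocities in cones and on the unit sphere -/

section RealTangent

variable {E : Type*} [NormedAddCommGroup E] [InnerProductSpace ℝ E]

theorem inner_velocity_of_norm_eq_one {γ : ℝ → E} {x v : E} (h0 : γ 0 = x)
    (hγ : ∀ᶠ t in 𝓝 (0 : ℝ), ‖γ t‖ = 1) (hv : HasDerivAt γ v 0) : inner ℝ x v = 0 := by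
  have h1 := hv.norm_sq
  have h2 : HasDerivAt (fun t => ‖γ t‖ ^ 2) 0 (0 : ℝ) :=
    (hasDerivAt_const (0 : ℝ) (1 : ℝ)).congr_of_eventuallyEq (hγ.mono fun t ht => by simp [ht])
  have := h1.unique h2
  rw [h0] at this
  linarith

/-- The curve `γ / ‖γ‖` stays in the cone `S` and has unit norm. -/
theorem IsVelocity.normalize {S : Set E} (hS : ∀ c : ℝ, 0 < c → ∀ y ∈ S, c • y ∈ S)
    {x v : E} (hx : ‖x‖ = 1) (hv : IsVelocity S x v) :
    IsVelocity {y | y ∈ S ∧ ‖y‖ = 1} x (v - inner ℝ x v • x) := by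
  obtain ⟨γ, hγ, h0, hmem, hd⟩ := hv
  have hne0 : γ 0 ≠ 0 := by
    rw [h0, ← norm_ne_zero_iff, hx]; exact one_ne_zero
  have hne : ∀ᶠ t in 𝓝 (0 : ℝ), γ t ≠ 0 := hd.continuousAt.eventually_ne hne0
  have hsc : ContDiffAt ℝ ∞ (fun t => ‖γ t‖⁻¹) 0 :=
    (hγ.norm ℝ hne0).inv (norm_ne_zero_iff.mpr hne0)
  have hscd := (hsc.differentiableAt (by simp)).hasDerivAt
  set b := deriv (fun t => ‖γ t‖⁻¹) 0
  have hδ := hscd.smul hd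
  have hnorm : ∀ᶠ t in 𝓝 (0 : ℝ), ‖‖γ t‖⁻¹ • γ t‖ = 1 := hne.mono fun t ht => by
    rw [norm_smul, norm_inv, norm_norm, inv_mul_cancel₀ (norm_ne_zero_iff.mpr ht)]
  have hδ' : HasDerivAt (fun t => ‖γ t‖⁻¹ • γ t) (v + b • x) 0 := by
    have h : HasDerivAt (fun t => ‖γ t‖⁻¹ • γ t) (‖γ 0‖⁻¹ • v + b • γ 0) 0 := hδ
    simpa [h0, hx] using h
  have hδ0 : ‖γ 0‖⁻¹ • γ 0 = x := by simp [h0, hx]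
  -- The derivative `b` of `1 / ‖γ‖` need not be computed: orthogonality of `v + b • x` to `x`
  -- determines it.
  have hb := inner_velocity_of_norm_eq_one hδ0 hnorm hδ'
  have hb' : b = -inner ℝ x v := by
    rw [inner_add_right, inner_smul_right, real_inner_self_eq_norm_sq, hx] at hb
    linarith
  refine ⟨fun t => ‖γ t‖⁻¹ • γ t, hsc.smul hγ, hδ0, ?_, ?_⟩
  · filter_upwards [hmem, hne, hnorm] with t h1 h2 h3
    exact ⟨hS _ (inv_pos.mpr (norm_pos_iff.mpr h2)) _ h1, h3⟩
  · rw [sub_eq_add_neg, ← neg_smul, ← hb']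
    exact hδ'

/-- The linear map `w ↦ w - ⟪x, w⟫ x` sends velocities in `S` to velocities in the normalized set,
hence span to span, and it fixes the vectors orthogonal to `x`. -/
theorem realTangentSpace_inter_sphere {S : Set E}
    (hS : ∀ c : ℝ, 0 < c → ∀ y ∈ S, c • y ∈ S) {x : E} (hx : ‖x‖ = 1) :
    realTangentSpace {y | y ∈ S ∧ ‖y‖ = 1} x = realTangentSpace S x ⊓ (ℝ ∙ x)ᗮ := by
  refine le_antisymm (Submodule.span_le.mpr ?_) ?_
  · rintro v ⟨γ, hγ, h0, hmem, hd⟩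
    refine ⟨Submodule.subset_span ⟨γ, hγ, h0, hmem.mono fun t h => h.1, hd⟩, ?_⟩
    exact Submodule.mem_orthogonal_singleton_iff_inner_right.mpr
      (inner_velocity_of_norm_eq_one h0 (hmem.mono fun t h => h.2) hd)
  · rintro v ⟨hv, hvx⟩
    have key : ∀ w ∈ realTangentSpace S x,
        w - inner ℝ x w • x ∈ realTangentSpace {y | y ∈ S ∧ ‖y‖ = 1} x := by
      intro w hw
      induction hw using Submodule.span_induction with
      | mem w hw => exact Submodule.subset_span (IsVelocity.normalize hS hx hw)
      | zero => simp
      | add w z _ _ hw hz =>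
        convert Submodule.add_mem _ hw hz using 1
        rw [inner_add_right, add_smul]; abel
      | smul c w _ hw =>
        convert Submodule.smul_mem _ c hw using 1
        rw [inner_smul_right, smul_sub, smul_smul]
    have := key v hv
    rwa [Submodule.mem_orthogonal_singleton_iff_inner_right.mp hvx, zero_smul, sub_zero] at this

theorem mem_realTangentSpace_self {S : Set E}
    (hS : ∀ c : ℝ, 0 < c → ∀ y ∈ S, c • y ∈ S) {x : E} (hx : x ∈ S) :
    x ∈ realTangentSpace S x := by
  -- The ray through `x` stays in the cone while `t > -1`.
  refine Submodule.subset_span ⟨fun t => (1 + t) • x, by fun_prop, by simp, ?_, ?_⟩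
  · filter_upwards [lt_mem_nhds (show (-1 : ℝ) < 0 by norm_num)] with t ht
    exact hS _ (by linarith) x hx
  · simpa using ((hasDerivAt_id (0 : ℝ)).const_add 1).smul_const x

theorem realTangentSpace_univ (x : E) : realTangentSpace (Set.univ : Set E) x = ⊤ := by
  refine eq_top_iff.mpr fun v _ => Submodule.subset_span
    ⟨fun t => x + t • v, by fun_prop, by simp, by simp, ?_⟩
  simpa using ((hasDerivAt_id (0 : ℝ)).smul_const v).const_add x

theorem realTangentSpace_sphere {x : E} (hx : ‖x‖ = 1) :
    realTangentSpace {y : E | ‖y‖ = 1} x = (ℝ ∙ x)ᗮ := by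
  have := realTangentSpace_inter_sphere (S := (Set.univ : Set E)) (fun _ _ _ _ => trivial) hx
  simpa [realTangentSpace_univ] using this

end RealTangent

/-! ### Interface Gram matrices of tensor trains -/

section Gram

variable {d : ℕ} {n : Fin d → ℕ} {r : Fin (d + 1) → ℕ}

theorem ttRank_smul (X : Tensor n) {c : ℝ} (hc : 0 < c) : ttRank (c • X) = ttRank X := by
  funext k
  have e : unfolding (c • X) k = (c : ℂ) • unfolding X k := by
    ext a b; simp [unfolding]
  have hu : (c : ℂ) ∈ nonZeroDivisors ℂ :=
    mem_nonZeroDivisors_of_ne_zero (by exact_mod_cast hc.ne')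
  simp only [ttRank, e]
  rw [Matrix.rank_smul_of_mem_nonZeroDivisors _ hu]

/-- Averaging over a coordinate on which `F` does not depend through its first argument. -/
theorem card_smul_sum_diagonal {M : Type*} [AddCommMonoid M] (m : Fin d)
    (F : ((k : Fin d) → Fin (n k)) → Fin (n m) → M)
    (hF : ∀ i j l, F (Function.update i m j) l = F i l) :
    n m • ∑ i, F i (i m) = ∑ j, ∑ i, F i j := by
  -- Swapping coordinate `m` of `i` with the free index is an involution.
  let e : Equiv.Perm (((k : Fin d) → Fin (n k)) × Fin (n m)) :=
    Function.Involutive.toPerm (fun p => (Function.update p.1 m p.2, p.1 m))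
      (fun p => by simp)
  have h1 : ∑ p : ((k : Fin d) → Fin (n k)) × Fin (n m), F p.1 (p.1 m) =
      ∑ p : ((k : Fin d) → Fin (n k)) × Fin (n m), F p.1 p.2 :=
    Fintype.sum_equiv e _ _ fun p => by
      change F p.1 (p.1 m) = F (Function.update p.1 m p.2) (p.1 m)
      rw [hF]
  rw [Fintype.sum_prod_type, Fintype.sum_prod_type_right] at h1
  simpa [Finset.smul_sum] using h1

/-- The sum over all multi-indices of the products `P_A(i)ᴴ P_B(i)` of interface matrices. -/
def interfaceGram (A B : Cores n r) (m : Fin (d + 1)) : Matrix (Fin (r m)) (Fin (r m)) ℂ :=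
  ∑ i, (partialProd A i m)ᴴ * partialProd B i m

theorem partialProd_update_index (U : Cores n r) (i : (k : Fin d) → Fin (n k)) (k : Fin d)
    (j : Fin (n k)) (m : Fin (d + 1)) :
    (m : ℕ) ≤ k → partialProd U (Function.update i k j) m = partialProd U i m := by
  induction m using Fin.induction with
  | zero => intro _; rfl
  | succ m ih =>
    intro h
    have hm : (m : ℕ) + 1 ≤ k := by simpa using h
    have hne : m ≠ k := by intro e; subst e; omega
    rw [partialProd_succ, partialProd_succ, ih (by simp; omega), Function.update_of_ne hne]

/-- The Gram sums run over all `d` indices, including those on which the partial products do not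
depend; the factor `n m` accounts for the change in multiplicity. -/
theorem interfaceGram_succ (A B : Cores n r) (m : Fin d) :
    n m • interfaceGram A B m.succ =
      ∑ j, (A m j)ᴴ * interfaceGram A B m.castSucc * B m j := by
  have h := card_smul_sum_diagonal m
    (fun i j => (A m j)ᴴ * ((partialProd A i m.castSucc)ᴴ * partialProd B i m.castSucc) * B m j)
    (fun i j l => by
      simp only [partialProd_update_index _ i m j m.castSucc (by simp)])
  simp only [interfaceGram, partialProd_succ, Matrix.conjTranspose_mul, Matrix.mul_sum,
    Matrix.sum_mul]
  simpa only [Matrix.mul_assoc] using h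

theorem leftUnfolding_conjTranspose_mul {p m q : ℕ} (A B : Fin m → Matrix (Fin p) (Fin q) ℂ) :
    (leftUnfolding A)ᴴ * leftUnfolding B = ∑ j, (A j)ᴴ * B j := by
  ext a b
  simp [Matrix.mul_apply, leftUnfolding, Matrix.sum_apply, Fintype.sum_prod_type_right]

/-- Left-orthogonality carries a scalar matrix through the recursion. The scalar only counts the
free indices, so nonzero mode sizes keep it nonzero. -/
theorem interfaceGram_self (hn : ∀ k, n k ≠ 0) {U : Cores n r} (hU : LeftOrthogonal U)
    (m : Fin (d + 1)) : (m : ℕ) < d → ∃ c : ℂ, c ≠ 0 ∧ interfaceGram U U m = c • 1 := by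
  induction m using Fin.induction with
  | zero =>
    intro _
    refine ⟨(Fintype.card ((k : Fin d) → Fin (n k)) : ℂ), ?_, ?_⟩
    · simp [Finset.prod_eq_zero_iff, hn]
    · simp [interfaceGram, partialProd_zero, ← Nat.cast_smul_eq_nsmul ℂ]
  | succ m ih =>
    intro h
    have hm : (m : ℕ) + 1 < d := by simpa using h
    obtain ⟨c, hc, e⟩ := ih (by simp)
    have hs := interfaceGram_succ U U m
    have hn' : (n m : ℂ) ≠ 0 := Nat.cast_ne_zero.mpr (hn m)
    have hu := hU m hm
    rw [leftUnfolding_conjTranspose_mul] at hu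
    simp only [e, Matrix.mul_smul, Matrix.smul_mul, Matrix.mul_one, ← Finset.smul_sum, hu] at hs
    refine ⟨(n m : ℂ)⁻¹ * c, mul_ne_zero (inv_ne_zero hn') hc, ?_⟩
    rw [mul_smul, ← hs, ← Nat.cast_smul_eq_nsmul ℂ, inv_smul_smul₀ hn']

theorem interfaceGram_update_succ (hn : ∀ k, n k ≠ 0) {U : Cores n r} (hU : LeftOrthogonal U)
    (k : Fin d) (A : Fin (n k) → Matrix (Fin (r k.castSucc)) (Fin (r k.succ)) ℂ) :
    ∃ c : ℂ, c ≠ 0 ∧ interfaceGram (Function.update U k A) U k.succ =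
      c • ((leftUnfolding A)ᴴ * leftUnfolding (U k)) := by
  obtain ⟨c, hc, e⟩ := interfaceGram_self hn hU k.castSucc (by simp)
  have hn' : (n k : ℂ) ≠ 0 := Nat.cast_ne_zero.mpr (hn k)
  have e' : interfaceGram (Function.update U k A) U k.castSucc = c • 1 := by
    rw [← e]
    simp only [interfaceGram]
    refine Finset.sum_congr rfl fun i _ => ?_
    rw [partialProd_update_of_le U i k A _ (by simp)]
  have hs := interfaceGram_succ (Function.update U k A) U k
  simp only [e', Function.update_self, Matrix.mul_smul, Matrix.smul_mul, Matrix.mul_one,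
    ← Finset.smul_sum, ← leftUnfolding_conjTranspose_mul] at hs
  refine ⟨(n k : ℂ)⁻¹ * c, mul_ne_zero (inv_ne_zero hn') hc, ?_⟩
  rw [mul_smul, ← hs, ← Nat.cast_smul_eq_nsmul ℂ, inv_smul_smul₀ hn']

theorem interfaceGram_eq_zero_of_lt (hn : ∀ k, n k ≠ 0) {A B : Cores n r} (k : Fin d)
    (h : interfaceGram A B k.succ = 0) (m : Fin (d + 1)) :
    (k : ℕ) < m → interfaceGram A B m = 0 := by
  induction m using Fin.induction with
  | zero => intro h; simp at h
  | succ m ih =>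
    intro hm
    by_cases hk : m = k
    · rw [hk, h]
    · have hlt : (k : ℕ) < m := by
        have h1 : (k : ℕ) < m + 1 := by simpa using hm
        have h2 : (m : ℕ) ≠ k := fun e => hk (Fin.ext e)
        omega
      have hs := interfaceGram_succ A B m
      simp only [ih (by simpa using hlt), Matrix.mul_zero, Matrix.zero_mul,
        Finset.sum_const_zero, ← Nat.cast_smul_eq_nsmul ℂ] at hs
      exact (smul_eq_zero.mp hs).resolve_left (Nat.cast_ne_zero.mpr (hn m))

theorem inner_ttTensor (h₀ : r 0 = 1) (h₁ : r (Fin.last d) = 1) (A B : Cores n r) :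
    inner ℂ (ttTensor h₀ h₁ A) (ttTensor h₀ h₁ B) =
      interfaceGram A B (Fin.last d) ⟨0, by omega⟩ ⟨0, by omega⟩ := by
  have : Subsingleton (Fin (r 0)) := by rw [h₀]; infer_instance
  simp only [PiLp.inner_apply, interfaceGram, Matrix.sum_apply, Matrix.mul_apply]
  refine Finset.sum_congr rfl fun i _ => ?_
  rw [Fintype.sum_subsingleton _ (⟨0, by omega⟩ : Fin (r 0))]
  simp [ttTensor, mul_comm]

theorem coreInner_eq_trace {p m q : ℕ} (A B : Fin m → Matrix (Fin p) (Fin q) ℂ) :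
    coreInner A B = ((leftUnfolding A)ᴴ * leftUnfolding B).trace := by
  simp only [coreInner, Matrix.trace, Matrix.diag, Matrix.mul_apply, Fintype.sum_prod_type,
    leftUnfolding, Matrix.conjTranspose_apply, Matrix.of_apply]
  rw [Finset.sum_comm]
  conv_rhs => rw [Finset.sum_comm]; enter [2, a]; rw [Finset.sum_comm]
  rw [Finset.sum_comm]

theorem inner_update_eq_zero_of_gauged (hn : ∀ k, n k ≠ 0) (h₀ : r 0 = 1)
    (h₁ : r (Fin.last d) = 1) {U W : Cores n r} (hU : LeftOrthogonal U) (hW : Gauged U W)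
    (k : Fin d) (hk : (k : ℕ) + 1 < d) :
    inner ℂ (ttTensor h₀ h₁ (Function.update U k (W k))) (ttTensor h₀ h₁ U) = 0 := by
  obtain ⟨c, -, e⟩ := interfaceGram_update_succ hn hU k (W k)
  rw [hW k hk, smul_zero] at e
  rw [inner_ttTensor, interfaceGram_eq_zero_of_lt hn k e _ (by simp)]
  rfl

theorem inner_update_last_eq_zero_iff (hn : ∀ k, n k ≠ 0) (h₀ : r 0 = 1)
    (h₁ : r (Fin.last d) = 1) {U : Cores n r} (hU : LeftOrthogonal U) (k : Fin d)
    (hk : (k : ℕ) + 1 = d)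
    (A : Fin (n k) → Matrix (Fin (r k.castSucc)) (Fin (r k.succ)) ℂ) :
    inner ℂ (ttTensor h₀ h₁ (Function.update U k A)) (ttTensor h₀ h₁ U) = 0 ↔
      coreInner A (U k) = 0 := by
  obtain ⟨c, hc, e⟩ := interfaceGram_update_succ hn hU k A
  have hl : Fin.last d = k.succ := Fin.ext (by simp [hk])
  have hs : r k.succ = 1 := hl ▸ h₁
  have : Subsingleton (Fin (r k.succ)) := by rw [hs]; infer_instance
  -- A variable `m` allows substitution, since `Fin.last d` and `k.succ` index different matrix
  -- types definitionally.
  have key : ∀ (m : Fin (d + 1)) (hm : r m = 1), m = k.succ →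
      interfaceGram (Function.update U k A) U m ⟨0, by omega⟩ ⟨0, by omega⟩ =
        c * coreInner A (U k) := by
    rintro m hm rfl
    rw [e, coreInner_eq_trace, Matrix.trace,
      Fintype.sum_subsingleton _ (⟨0, by omega⟩ : Fin (r k.succ))]
    rfl
  rw [inner_ttTensor, key _ h₁ hl]
  simp [hc]

theorem inner_variation_eq_zero_iff (hd : 0 < d) (hn : ∀ k, n k ≠ 0) (h₀ : r 0 = 1)
    (h₁ : r (Fin.last d) = 1) {U W : Cores n r} (hU : LeftOrthogonal U) (hW : Gauged U W) :
    inner ℂ (variation h₀ h₁ U W) (ttTensor h₀ h₁ U) = 0 ↔ LastOrthogonal U W := by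
  let k : Fin d := ⟨d - 1, by omega⟩
  have hk : (k : ℕ) + 1 = d := by simp only [k]; omega
  have hu : ∀ j : Fin d, j ≠ k → (j : ℕ) + 1 < d := fun j hj => by
    have : (j : ℕ) ≠ k := fun e => hj (Fin.ext e)
    omega
  rw [variation, sum_inner, Finset.sum_eq_single k
    (fun j _ hj => inner_update_eq_zero_of_gauged hn h₀ h₁ hU hW j (hu j hj)) (by simp),
    inner_update_last_eq_zero_iff hn h₀ h₁ hU k hk]
  refine ⟨fun h j hj => ?_, fun h => h k hk⟩
  obtain rfl : j = k := Fin.ext (by omega)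
  exact h

theorem ttTensor_mem_tangentFixedRank (hd : 0 < d) (h₀ : r 0 = 1) (h₁ : r (Fin.last d) = 1)
    (U : Cores n r) : ttTensor h₀ h₁ U ∈ tangentFixedRank h₀ h₁ U := by
  let k : Fin d := ⟨d - 1, by omega⟩
  -- Only the last core is varied, in its own direction; it carries no gauge condition.
  refine ⟨Pi.single k (U k), fun j hj => ?_, ?_⟩
  · have hne : j ≠ k := by rintro rfl; simp only [k] at hj; omega
    simpa [Pi.single_eq_of_ne hne] using Gauged.zero U j hj
  · rw [variation, Finset.sum_eq_single k]
    · simp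
    · intro j _ hj
      rw [Pi.single_eq_of_ne hj]
      ext i
      -- Linearity at `1 • 0 + 0` forces a product with a zero core to vanish.
      have := partialProd_update_lin U i j 0 0 1 (Fin.last d) (by simp)
      simp only [smul_zero, add_zero, one_smul, left_eq_add] at this
      simp [ttTensor, this]
    · simp

theorem tangentUnitSphere_eq (X : Tensor n) : tangentUnitSphere X = (ℂ ∙ X)ᗮ := by
  ext V
  exact Submodule.mem_orthogonal_singleton_iff_inner_left.symm

theorem tangentNormalizedFixedRank_eq (hd : 0 < d) (hn : ∀ k, n k ≠ 0) (h₀ : r 0 = 1)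
    (h₁ : r (Fin.last d) = 1) {U : Cores n r} (hU : LeftOrthogonal U) :
    tangentNormalizedFixedRank h₀ h₁ U =
      tangentFixedRank h₀ h₁ U ⊓ tangentUnitSphere (ttTensor h₀ h₁ U) := by
  ext T
  constructor
  · rintro ⟨W, hW, hW', rfl⟩
    exact ⟨⟨W, hW, rfl⟩, (inner_variation_eq_zero_iff hd hn h₀ h₁ hU hW).mpr hW'⟩
  · rintro ⟨⟨W, hW, rfl⟩, h⟩
    exact ⟨W, hW, (inner_variation_eq_zero_iff hd hn h₀ h₁ hU hW).mp h, rfl⟩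

/-- An empty mode leaves no entries, so the tensor would be zero. -/
theorem size_ne_zero_of_norm_eq_one {X : Tensor n} (hX : ‖X‖ = 1) (k : Fin d) : n k ≠ 0 := by
  intro hk
  have : IsEmpty ((k : Fin d) → Fin (n k)) := ⟨fun i => by
    have := (i k).isLt
    omega⟩
  have h0 : X = 0 := by ext i; exact isEmptyElim i
  simp [h0] at hX

end Gram

end NTT

theorem mainTheorem5 {d : ℕ} (hd : 0 < d) (n : Fin d → ℕ) (r : Fin (d + 1) → ℕ)
    (h₀ : r 0 = 1) (h₁ : r (Fin.last d) = 1)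
    (X : NTT.Tensor n) (hX : X ∈ NTT.normalizedFixedRank n r) :
    (∀ U : NTT.Cores n r, NTT.LeftOrthogonal U → NTT.ttTensor h₀ h₁ U = X →
      (NTT.tangentNormalizedFixedRank h₀ h₁ U).starProjection =
          (NTT.tangentUnitSphere X).starProjection ∘L
            (NTT.tangentFixedRank h₀ h₁ U).starProjection ∧
        (NTT.tangentUnitSphere X).starProjection ∘L
            (NTT.tangentFixedRank h₀ h₁ U).starProjection =
          (NTT.tangentFixedRank h₀ h₁ U).starProjection ∘L
            (NTT.tangentUnitSphere X).starProjection) ∧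
    ((NTT.realTangentSpace (NTT.normalizedFixedRank n r) X).starProjection =
          (NTT.realTangentSpace (NTT.unitSphere n) X).starProjection ∘L
            (NTT.realTangentSpace (NTT.fixedRank n r) X).starProjection ∧
        (NTT.realTangentSpace (NTT.unitSphere n) X).starProjection ∘L
            (NTT.realTangentSpace (NTT.fixedRank n r) X).starProjection =
          (NTT.realTangentSpace (NTT.fixedRank n r) X).starProjection ∘L
            (NTT.realTangentSpace (NTT.unitSphere n) X).starProjection) := by
  obtain ⟨hr, hX1⟩ := hX
  have hS : ∀ c : ℝ, 0 < c → ∀ Y ∈ NTT.fixedRank n r, c • Y ∈ NTT.fixedRank n r :=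
    fun c hc Y hY => (NTT.ttRank_smul Y hc).trans hY
  have hsphere := NTT.realTangentSpace_sphere hX1
  refine ⟨?_, NTT.starProjection_identities (NTT.mem_realTangentSpace_self hS hr) hsphere
    ((NTT.realTangentSpace_inter_sphere hS hX1).trans (congrArg _ hsphere.symm))⟩
  rintro U hU rfl
  exact NTT.starProjection_identities (NTT.ttTensor_mem_tangentFixedRank hd h₀ h₁ U)
    (NTT.tangentUnitSphere_eq _)
    (NTT.tangentNormalizedFixedRank_eq hd (NTT.size_ne_zero_of_norm_eq_one hX1) h₀ h₁ hU)
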